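/- Let $R$ be a commutative Noetherian ring with identity, $\mathfrak a$ an ideal of $R$, and $X$ an arbitrary $R$-module. Write $H^i_{\mathfrak a}(X)=\varinjlim_n \mathrm{Ext}^i_R(R/\mathfrak a^n,X)$ for the $i$-th local cohomology module, $\Gamma_{\mathfrak a}(X)=\{x\in X : \mathfrak a^n x=0 \text{ for some } n\}$, and $\mathrm{cd}(\mathfrak a,X)$ for the largest integer $i$ with $H^i_{\mathfrak a}(X)\neq 0$. An $R$-module $Y$ is called $\mathfrak a$-cofinite if $\mathrm{Supp}(Y)\subseteq V(\mathfrak a)$ and $\mathrm{Ext}^i_R(R/\mathfrak a,Y)$ is finitely generated for all $i\ge 0$. Suppose that $\mathrm{cd}(\mathfrak a,X)=1$. Then for all $i\ge 0$ there is an isomorphism of $R$-modules $$\mathrm{Ext}^i_R(R/\mathfrak a,H^1_{\mathfrak a}(X))\cong \mathrm{Ext}^{i+1}_R(R/\mathfrak a,X/\Gamma_{\mathfrak a}(X)).$$ In particular, if $X$ is finitely generated, then $H^i_{\mathfrak a}(X)$ is $\mathfrak a$-cofinite for all $i\ge 0$. -/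

import Mathlib

open CategoryTheory Opposite

universe u

noncomputable section

/-- `extModule i M N` is the `R`-module `Ext^i_R(M, N)`. -/
abbrev extModule {R : Type u} [CommRing R] (i : ℕ) (M N : ModuleCat.{u} R) : ModuleCat.{u} R :=
  ((Ext R (ModuleCat.{u} R) i).obj (op M)).obj N

/-- `localCohomologyModule a i X` is the `i`-th local cohomology module `H^i_a(X)`, that is,
the direct limit over `n` of `Ext^i_R(R / a ^ n, X)`. -/
abbrev localCohomologyModule {R : Type u} [CommRing R] (a : Ideal R) (i : ℕ)
    (X : ModuleCat.{u} R) : ModuleCat.{u} R :=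
  (localCohomology a i).obj X

/-- The `a`-torsion submodule `Γ_a(X)` of `X`: the elements killed by some power of `a`. -/
def idealTorsion {R : Type u} [CommRing R] (a : Ideal R) (X : Type u) [AddCommGroup X]
    [Module R X] : Submodule R X where
  carrier := {x | ∃ n : ℕ, ∀ r ∈ a ^ n, r • x = 0}
  zero_mem' := ⟨0, fun r _ => smul_zero r⟩
  add_mem' := by
    rintro x y ⟨m, hm⟩ ⟨n, hn⟩
    refine ⟨max m n, fun r hr => ?_⟩
    rw [smul_add, hm r (Ideal.pow_le_pow_right (le_max_left m n) hr),
      hn r (Ideal.pow_le_pow_right (le_max_right m n) hr), add_zero]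
  smul_mem' := by
    rintro c x ⟨n, hn⟩
    exact ⟨n, fun r hr => by rw [smul_comm, hn r hr, smul_zero]⟩

/-- The cohomological dimension `cd(a, X)`: the supremum, in `ℕ ∪ {-∞, ∞}`, of the integers `i`
with `H^i_a(X) ≠ 0`. -/
def cohomologicalDimension {R : Type u} [CommRing R] (a : Ideal R) (X : ModuleCat.{u} R) :
    WithBot ℕ∞ :=
  ⨆ i : {i : ℕ // Nontrivial (localCohomologyModule a i X)}, ((i.1 : ℕ∞) : WithBot ℕ∞)

/-- `cd(a, X) = d` for an integer `d` means that `d` is the largest integer `i` with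
`H^i_a(X) ≠ 0`. -/
theorem cohomologicalDimension_eq_iff {R : Type u} [CommRing R] (a : Ideal R)
    (X : ModuleCat.{u} R) (d : ℕ) :
    cohomologicalDimension a X = ((d : ℕ∞) : WithBot ℕ∞) ↔
      IsGreatest {i : ℕ | Nontrivial (localCohomologyModule a i X)} d := by
  unfold cohomologicalDimension
  constructor
  · intro h
    have hub : ∀ i : ℕ, Nontrivial (localCohomologyModule a i X) → i ≤ d := by
      intro i hi
      have h1 := le_iSup (fun i : {i : ℕ // Nontrivial (localCohomologyModule a i X)} =>
        ((i.1 : ℕ∞) : WithBot ℕ∞)) ⟨i, hi⟩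
      rw [h] at h1
      exact_mod_cast h1
    refine ⟨?_, fun i hi => hub i hi⟩
    by_contra hd
    have hlt : ∀ i : ℕ, Nontrivial (localCohomologyModule a i X) → i < d := fun i hi =>
      lt_of_le_of_ne (hub i hi) (fun e => hd (e ▸ hi))
    rcases d with _ | e
    · have h1 : (⨆ i : {i : ℕ // Nontrivial (localCohomologyModule a i X)},
          ((i.1 : ℕ∞) : WithBot ℕ∞)) ≤ ⊥ :=
        iSup_le fun i => absurd (hlt i.1 i.2) (Nat.not_lt_zero _)
      rw [h] at h1
      exact absurd h1 (by simp)
    · have h1 : (⨆ i : {i : ℕ // Nontrivial (localCohomologyModule a i X)},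
          ((i.1 : ℕ∞) : WithBot ℕ∞)) ≤ ((e : ℕ∞) : WithBot ℕ∞) :=
        iSup_le fun i => by exact_mod_cast Nat.lt_succ_iff.mp (hlt i.1 i.2)
      rw [h] at h1
      have h2 : e + 1 ≤ e := by exact_mod_cast h1
      omega
  · rintro ⟨hd, hub⟩
    refine le_antisymm (iSup_le fun i => by exact_mod_cast hub i.2) ?_
    exact le_iSup (fun i : {i : ℕ // Nontrivial (localCohomologyModule a i X)} =>
        ((i.1 : ℕ∞) : WithBot ℕ∞)) ⟨d, hd⟩

/-- An `R`-module `X` is `a`-cofinite if `Supp X ⊆ V(a)` and `Ext^i_R(R / a, X)` is a finitely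
generated `R`-module for all `i`. -/
def IsIdealCofinite {R : Type u} [CommRing R] (a : Ideal R) (X : ModuleCat.{u} R) : Prop :=
  Module.support R X ⊆ PrimeSpectrum.zeroLocus (a : Set R) ∧
    ∀ i : ℕ, Module.Finite R (extModule i (ModuleCat.of R (R ⧸ a)) X)

end

/-! Write Γ for `a`-torsion and X' = X/Γ(X). Since `R` is Noetherian, Artin–Rees shows that Γ of an
injective module is injective, hence a direct summand. So X', being torsion-free, embeds in a
torsion-free injective E; put N = E/X'. If a power of `a` kills M, then Ext^i(M, E) = 0 for every i,
whence Ext^i(M, N) ≅ Ext^{i+1}(M, X').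

Taking M = R/a^n, i = 0 and the limit over n gives H^1(X) ≅ H^1(X') ≅ Γ(N), as Γ(X) has no higher
local cohomology (`nonempty_localCohomologyModule_one_equiv`). The hypothesis on cd kills H^j(X) for
j ≥ 2, so H^j(N) = 0 for j ≥ 1, and N/Γ(N) has no local cohomology at all. Then Ext^i(R/a, N/Γ(N)) =
0 for every i (`subsingleton_ext_of_extEventuallyZero`), and Ext^i(R/a, Γ(N)) ≅ Ext^i(R/a, N) ≅
Ext^{i+1}(R/a, X').

For finitely generated X, this isomorphism gives cofiniteness of H^1; H^0 embeds in X and the other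
H^i vanish. -/

noncomputable section

/-! ### Comparison of the derived-functor `Ext` with `Abelian.Ext`, natural in the first variable.
-/

section ExtComparison

variable {R : Type u} [CommRing R]

lemma CategoryTheory.ProjectiveResolution.extMk_zero_eq_zero_iff {X Y : ModuleCat.{u} R}
    (P : ProjectiveResolution X) (f : P.complex.X 0 ⟶ Y) (m : ℕ) (hm : 0 + 1 = m)
    (hf : P.complex.d m 0 ≫ f = 0) : P.extMk f m hm hf = 0 ↔ f = 0 := by
  simp only [← P.extEquivCohomologyClass.apply_eq_iff_eq,
    ProjectiveResolution.extEquivCohomologyClass_extMk,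
    ProjectiveResolution.extEquivCohomologyClass_zero,
    CochainComplex.HomComplex.CohomologyClass.mk_eq_zero_iff]
  rw [CochainComplex.HomComplex.Cocycle.toSingleMk_mem_coboundaries_iff _ _ _ _ _ 1 (by simp)]
  -- The cochain complex has P_n in degree -n, so its degree 1 term is zero and there are no nonzero
  -- coboundaries.
  have hz : P.cochainComplex.d (-((0 : ℕ) : ℤ)) 1 = 0 :=
    (P.cochainComplex.isZero_of_isStrictlyLE 0 1 (by simp)).eq_of_tgt _ _
  simp only [hz, Limits.zero_comp]
  constructor
  · rintro ⟨_, h⟩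
    rw [← cancel_epi (P.cochainComplexXIso (-((0 : ℕ) : ℤ)) 0 rfl).hom, ← h, Limits.comp_zero]
  · rintro rfl
    exact ⟨0, by simp⟩

lemma CategoryTheory.ProjectiveResolution.smul_extMk {X Y : ModuleCat.{u} R}
    (P : ProjectiveResolution X) {n : ℕ} (r : R) (f : P.complex.X n ⟶ Y) (m : ℕ) (hm : n + 1 = m)
    (hf : P.complex.d m n ≫ f = 0) :
    r • P.extMk f m hm hf = P.extMk (r • f) m hm (by simp [hf]) := by
  rw [Abelian.Ext.smul_eq_comp_mk₀, ProjectiveResolution.extMk_comp_mk₀]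
  simp

variable {X : ModuleCat.{u} R} (P : ProjectiveResolution X) (Y : ModuleCat.{u} R) (n : ℕ)

/-- The inclusion of the cocycles of `Hom(P, Y)` into the module of morphisms `P_n ⟶ Y`. -/
def cyclesToHom : (P.complex.linearYonedaObj R Y).cycles n →ₗ[R] (P.complex.X n ⟶ Y) :=
  ((P.complex.linearYonedaObj R Y).iCycles n).hom

lemma d_comp_cyclesToHom (z : (P.complex.linearYonedaObj R Y).cycles n) :
    P.complex.d (n + 1) n ≫ cyclesToHom P Y n z = 0 :=
  ConcreteCategory.congr_hom ((P.complex.linearYonedaObj R Y).iCycles_d n (n + 1)) z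

/-- The class in `Ext` of a cocycle of `Hom(P, Y)`, for a projective resolution `P` of `X`. -/
def cyclesToExt : (P.complex.linearYonedaObj R Y).cycles n →ₗ[R] Abelian.Ext X Y n where
  toFun z := P.extMk (cyclesToHom P Y n z) (n + 1) rfl (d_comp_cyclesToHom P Y n z)
  map_add' z w := by
    simp only [map_add, ProjectiveResolution.add_extMk]
  map_smul' r z := by
    simp only [map_smul, ProjectiveResolution.smul_extMk, RingHom.id_apply]

lemma cyclesToExt_apply (z : (P.complex.linearYonedaObj R Y).cycles n) :
    cyclesToExt P Y n z =
      P.extMk (cyclesToHom P Y n z) (n + 1) rfl (d_comp_cyclesToHom P Y n z) :=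
  rfl

lemma HomologicalComplex.homologyπ_apply_eq_zero_iff {ι : Type*} {c : ComplexShape ι}
    (K : HomologicalComplex (ModuleCat.{u} R) c) (i j : ι) (hi : c.prev j = i) (z : K.cycles j) :
    (K.homologyπ j).hom z = 0 ↔ ∃ w : K.X i, (K.d i j).hom w = (K.iCycles j).hom z := by
  have hex : (ShortComplex.mk _ _ (K.toCycles_comp_homologyπ i j)).Exact :=
    ShortComplex.exact_of_g_is_cokernel _ (K.homologyIsCokernel i j hi)
  rw [ShortComplex.moduleCat_exact_iff] at hex
  have hinj : Function.Injective (K.iCycles j).hom :=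
    (ModuleCat.mono_iff_injective _).1 inferInstance
  have hd (w : K.X i) : (K.d i j).hom w = (K.iCycles j).hom ((K.toCycles i j).hom w) :=
    (ConcreteCategory.congr_hom (K.toCycles_i i j) w).symm
  constructor
  · intro hz
    obtain ⟨w, hw⟩ := hex z hz
    exact ⟨w, (hd w).trans (congrArg _ hw)⟩
  · rintro ⟨w, hw⟩
    obtain rfl := hinj ((hd w).symm.trans hw)
    exact ConcreteCategory.congr_hom (K.toCycles_comp_homologyπ i j) w

lemma cyclesToExt_eq_zero_iff (z : (P.complex.linearYonedaObj R Y).cycles n) :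
    cyclesToExt P Y n z = 0 ↔ ((P.complex.linearYonedaObj R Y).homologyπ n).hom z = 0 := by
  rw [cyclesToExt_apply]
  cases n with
  | zero =>
    -- Degree 0 has no predecessor, so `prev 0` takes the default value 0; the differential from 0
    -- to itself is zero.
    rw [ProjectiveResolution.extMk_zero_eq_zero_iff,
      HomologicalComplex.homologyπ_apply_eq_zero_iff _ 0 0 (by simp)]
    have hd : (P.complex.linearYonedaObj R Y).d 0 0 = 0 :=
      HomologicalComplex.shape _ _ _ (by simp)
    rw [hd]
    exact ⟨fun h => ⟨0, h.symm⟩, fun ⟨_, h⟩ => h.symm⟩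
  | succ p =>
    rw [ProjectiveResolution.extMk_eq_zero_iff _ _ _ _ _ p rfl,
      HomologicalComplex.homologyπ_apply_eq_zero_iff _ p (p + 1) (by simp)]
    rfl

lemma cyclesToExt_surjective : Function.Surjective (cyclesToExt P Y n) := by
  intro ξ
  obtain ⟨f, hf, rfl⟩ := P.extMk_surjective ξ (n + 1) rfl
  have hex : (ShortComplex.mk _ _ ((P.complex.linearYonedaObj R Y).iCycles_d n (n + 1))).Exact :=
    ShortComplex.exact_of_f_is_kernel _
      ((P.complex.linearYonedaObj R Y).cyclesIsKernel n (n + 1) (by simp))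
  rw [ShortComplex.moduleCat_exact_iff] at hex
  obtain ⟨z, hz⟩ := hex f hf
  have hz' : cyclesToHom P Y n z = f := hz
  refine ⟨z, ?_⟩
  simp only [cyclesToExt_apply, hz']

lemma homologyπ_surjective : Function.Surjective
    ((P.complex.linearYonedaObj R Y).homologyπ n).hom :=
  (ModuleCat.epi_iff_surjective _).1 inferInstance

/-- The cohomology of `Hom(P, Y)` is `Ext`, for a projective resolution `P` of `X`. -/
def homologyLinearEquivExt :
    (P.complex.linearYonedaObj R Y).homology n ≃ₗ[R] Abelian.Ext X Y n :=
  (LinearMap.quotKerEquivOfSurjective _ (homologyπ_surjective P Y n)).symm ≪≫ₗ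
    Submodule.quotEquivOfEq _ _ (by
      ext z
      exact (cyclesToExt_eq_zero_iff P Y n z).symm) ≪≫ₗ
    LinearMap.quotKerEquivOfSurjective _ (cyclesToExt_surjective P Y n)

lemma homologyLinearEquivExt_homologyπ (z : (P.complex.linearYonedaObj R Y).cycles n) :
    homologyLinearEquivExt P Y n (((P.complex.linearYonedaObj R Y).homologyπ n).hom z) =
      cyclesToExt P Y n z := by
  have h : (LinearMap.quotKerEquivOfSurjective _ (homologyπ_surjective P Y n)).symm
      (((P.complex.linearYonedaObj R Y).homologyπ n).hom z) = Submodule.Quotient.mk z := by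
    rw [LinearEquiv.symm_apply_eq]
    rfl
  simp only [homologyLinearEquivExt, LinearEquiv.trans_apply, h]
  rfl

variable (X) in
/-- The comparison between the two definitions of `Ext` of modules. -/
def extModuleLinearEquiv : extModule n X Y ≃ₗ[R] Abelian.Ext X Y n :=
  ((projectiveResolution X).isoExt n Y).toLinearEquiv ≪≫ₗ
    homologyLinearEquivExt (projectiveResolution X) Y n

variable {X' : ModuleCat.{u} R} {P} {P' : ProjectiveResolution X'} {g : X' ⟶ X}

/-- The map of complexes `Hom(P, Y) ⟶ Hom(P', Y)` induced by a map of resolutions. -/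
def linearYonedaMap (φ : P'.complex ⟶ P.complex) :
    P.complex.linearYonedaObj R Y ⟶ P'.complex.linearYonedaObj R Y where
  f i := ((linearYoneda R _).obj Y).map (φ.f i).op
  comm' i j _ := by
    ext (f : P.complex.X i ⟶ Y)
    exact (φ.comm_assoc j i f).symm

lemma homologyLinearEquivExt_naturality (φ : ProjectiveResolution.Hom P' P g)
    (x : (P.complex.linearYonedaObj R Y).homology n) :
    homologyLinearEquivExt P' Y n
      ((HomologicalComplex.homologyMap (linearYonedaMap Y φ.hom) n).hom x) =
    (Abelian.Ext.mk₀ g).comp (homologyLinearEquivExt P Y n x) (zero_add n) := by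
  obtain ⟨z, rfl⟩ := homologyπ_surjective P Y n x
  have h1 : (HomologicalComplex.homologyMap (linearYonedaMap Y φ.hom) n).hom
      (((P.complex.linearYonedaObj R Y).homologyπ n).hom z) =
      ((P'.complex.linearYonedaObj R Y).homologyπ n).hom
        ((HomologicalComplex.cyclesMap (linearYonedaMap Y φ.hom) n).hom z) :=
    ConcreteCategory.congr_hom
      (HomologicalComplex.homologyπ_naturality (linearYonedaMap Y φ.hom) n) z
  rw [h1, homologyLinearEquivExt_homologyπ, homologyLinearEquivExt_homologyπ]
  rw [cyclesToExt_apply, cyclesToExt_apply, ProjectiveResolution.mk₀_comp_extMk _ _ _ _ φ]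
  have h2 : cyclesToHom P' Y n
      ((HomologicalComplex.cyclesMap (linearYonedaMap Y φ.hom) n).hom z) =
      φ.hom.f n ≫ cyclesToHom P Y n z :=
    ConcreteCategory.congr_hom
      (HomologicalComplex.cyclesMap_i (linearYonedaMap Y φ.hom) n) z
  simp only [h2]

/-- Pastes two naturality squares after inverting their isomorphisms. `isoExt` is such a composite
of inverses, up to passing to opposite categories. -/
lemma CategoryTheory.Iso.comp_inv_comp_inv_of_hom_comp {C : Type*} [Category* C]
    {a a' b b' c c' : C} {m : a ⟶ a'} {H : b ⟶ b'} {h : c ⟶ c'} (A : b ≅ a) (A' : b' ≅ a')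
    (O : c ≅ b) (O' : c' ≅ b') (h₁ : A.hom ≫ m = H ≫ A'.hom) (h₂ : O.hom ≫ H = h ≫ O'.hom) :
    m ≫ A'.inv ≫ O'.inv = A.inv ≫ O.inv ≫ h := by
  rw [← cancel_epi A.hom, reassoc_of% h₁, Iso.hom_inv_id_assoc, Iso.hom_inv_id_assoc,
    ← cancel_epi O.hom, reassoc_of% h₂, Iso.hom_inv_id_assoc, Iso.hom_inv_id, Category.comp_id]

lemma isoExt_naturality (φ : ProjectiveResolution.Hom P' P g) :
    ((Ext R (ModuleCat.{u} R) n).map g.op).app Y ≫ (P'.isoExt n Y).hom =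
      (P.isoExt n Y).hom ≫ HomologicalComplex.homologyMap (linearYonedaMap Y φ.hom) n := by
  have h1 := P'.isoLeftDerivedObj_hom_naturality g P φ.hom φ.hom_f_zero_comp_π_f_zero
    ((linearYoneda R (ModuleCat.{u} R)).obj Y).rightOp n
  have h2 := HomologicalComplex.homologyOp_hom_naturality (linearYonedaMap Y φ.hom) n
  exact CategoryTheory.Iso.comp_inv_comp_inv_of_hom_comp
    (P.isoLeftDerivedObj ((linearYoneda R (ModuleCat.{u} R)).obj Y).rightOp n).unop
    (P'.isoLeftDerivedObj ((linearYoneda R (ModuleCat.{u} R)).obj Y).rightOp n).unop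
    ((P.complex.linearYonedaObj R Y).homologyOp n).unop
    ((P'.complex.linearYonedaObj R Y).homologyOp n).unop
    (congrArg Quiver.Hom.unop h1) (congrArg Quiver.Hom.unop h2)

/-- Turns the transition maps of the system defining local cohomology into precomposition in
`Abelian.Ext`. -/
lemma extModuleLinearEquiv_naturality (g : X' ⟶ X) (x : extModule n X Y) :
    extModuleLinearEquiv X' Y n ((((Ext R (ModuleCat.{u} R) n).map g.op).app Y).hom x) =
      (Abelian.Ext.mk₀ g).comp (extModuleLinearEquiv X Y n x) (zero_add n) := by
  let φ : ProjectiveResolution.Hom (projectiveResolution X') (projectiveResolution X) g :=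
    { hom := ProjectiveResolution.lift g _ _
      hom_f_zero_comp_π_f_zero := by
        rw [← HomologicalComplex.comp_f, ProjectiveResolution.lift_commutes]
        rfl }
  refine Eq.trans ?_ (homologyLinearEquivExt_naturality Y n φ _)
  exact congrArg (homologyLinearEquivExt (projectiveResolution X') Y n)
    (ConcreteCategory.congr_hom (isoExt_naturality Y n φ) x)

end ExtComparison

/-! ### Local cohomology classes represented by elements of Ext^i(R/a^n, X). -/

section LocalCohomologyElements

variable {R : Type u} [CommRing R] (a : Ideal R)

/-- The module `R / a ^ n`. -/
abbrev powQuotient (n : ℕ) : ModuleCat.{u} R := ModuleCat.of R (R ⧸ a ^ n)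

/-- The projection `R / a ^ m ⟶ R / a ^ n` for `n ≤ m`. -/
def powQuotientMap {n m : ℕ} (h : n ≤ m) : powQuotient a m ⟶ powQuotient a n :=
  ModuleCat.ofHom (Submodule.mapQ (a ^ m) (a ^ n) LinearMap.id (Ideal.pow_le_pow_right h))

lemma powQuotientMap_comp {n m k : ℕ} (h : n ≤ m) (h' : m ≤ k) :
    powQuotientMap a h' ≫ powQuotientMap a h = powQuotientMap a (h.trans h') := by
  ext
  rfl

variable (i : ℕ) (X : ModuleCat.{u} R)

/-- The restriction map `Ext^i(R / a ^ n, X) → Ext^i(R / a ^ m, X)` for `n ≤ m`. -/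
def extRestrict {n m : ℕ} (h : n ≤ m) :
    Abelian.Ext (powQuotient a n) X i →ₗ[R] Abelian.Ext (powQuotient a m) X i :=
  (Abelian.Ext.mk₀ (powQuotientMap a h)).precompOfLinear R X (zero_add i)

lemma extRestrict_apply {n m : ℕ} (h : n ≤ m) (ξ : Abelian.Ext (powQuotient a n) X i) :
    extRestrict a i X h ξ = (Abelian.Ext.mk₀ (powQuotientMap a h)).comp ξ (zero_add i) :=
  rfl

/-- The canonical map `Ext^i(R / a ^ n, X) → H^i_a(X)`. -/
def localCohomologyι (n : ℕ) :
    Abelian.Ext (powQuotient a n) X i →ₗ[R] localCohomologyModule a i X :=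
  ((Limits.colimit.ι (localCohomology.diagram
    (localCohomology.idealPowersDiagram a) i) (op (op n))).app X).hom ∘ₗ
    (extModuleLinearEquiv (powQuotient a n) X i).symm.toLinearMap

/-- The directed system defining the local cohomology of `X`. -/
def localCohomologySystem : (ℕᵒᵖ)ᵒᵖ ⥤ ModuleCat.{u} R :=
  localCohomology.diagram (localCohomology.idealPowersDiagram a) i ⋙ (evaluation _ _).obj X

/-- The colimit cocone with point the local cohomology of `X`. -/
def localCohomologyCocone : Limits.Cocone (localCohomologySystem a i X) :=
  ((evaluation _ _).obj X).mapCocone (Limits.colimit.cocone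
    (localCohomology.diagram (localCohomology.idealPowersDiagram a) i))

/-- Local cohomology is a colimit of `Ext` modules. -/
def localCohomologyCoconeIsColimit : Limits.IsColimit (localCohomologyCocone a i X) :=
  Limits.isColimitOfPreserves ((evaluation _ _).obj X) (Limits.colimit.isColimit _)

lemma extModuleLinearEquiv_system_map {n m : ℕ} (h : n ≤ m) (x : extModule i (powQuotient a n) X) :
    extModuleLinearEquiv (powQuotient a m) X i
      (((localCohomologySystem a i X).map (homOfLE h).op.op).hom x) =
    extRestrict a i X h (extModuleLinearEquiv (powQuotient a n) X i x) :=
  extModuleLinearEquiv_naturality X i (powQuotientMap a h) x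

lemma localCohomologyι_extModuleLinearEquiv (n : ℕ) (x : extModule i (powQuotient a n) X) :
    localCohomologyι a i X n (extModuleLinearEquiv (powQuotient a n) X i x) =
      ((localCohomologyCocone a i X).ι.app (op (op n))).hom x :=
  congrArg ((localCohomologyCocone a i X).ι.app (op (op n))).hom
    ((extModuleLinearEquiv (powQuotient a n) X i).symm_apply_apply x)

lemma localCohomologyι_extRestrict {n m : ℕ} (h : n ≤ m)
    (ξ : Abelian.Ext (powQuotient a n) X i) :
    localCohomologyι a i X m (extRestrict a i X h ξ) = localCohomologyι a i X n ξ := by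
  obtain ⟨x, rfl⟩ := (extModuleLinearEquiv (powQuotient a n) X i).surjective ξ
  rw [← extModuleLinearEquiv_system_map]
  rw [localCohomologyι_extModuleLinearEquiv]
  exact (localCohomologyι_extModuleLinearEquiv a i X m _).trans
    (ConcreteCategory.congr_hom ((localCohomologyCocone a i X).w (homOfLE h).op.op) x)

instance : Limits.PreservesColimitsOfShape (ℕᵒᵖ)ᵒᵖ (forget (ModuleCat.{u} R)) :=
  have := Limits.preservesFilteredColimitsOfSize_shrink.{0, u, 0, u} (forget (ModuleCat.{u} R))
  inferInstance

lemma exists_localCohomologyι_eq (x : localCohomologyModule a i X) :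
    ∃ n ξ, localCohomologyι a i X n ξ = x := by
  obtain ⟨n, y, hy⟩ := Limits.Concrete.isColimit_exists_rep _
    (localCohomologyCoconeIsColimit a i X) x
  exact ⟨n.unop.unop, extModuleLinearEquiv _ X i y,
    (localCohomologyι_extModuleLinearEquiv a i X n.unop.unop y).trans hy⟩

lemma localCohomologyι_eq_zero_iff (n : ℕ) (ξ : Abelian.Ext (powQuotient a n) X i) :
    localCohomologyι a i X n ξ = 0 ↔ ∃ m, ∃ h : n ≤ m, extRestrict a i X h ξ = 0 := by
  constructor
  · intro h0
    obtain ⟨x, rfl⟩ := (extModuleLinearEquiv (powQuotient a n) X i).surjective ξ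
    rw [localCohomologyι_extModuleLinearEquiv] at h0
    obtain ⟨k, f, g, hk⟩ := Limits.Concrete.isColimit_exists_of_rep_eq
      (F := localCohomologySystem a i X)
      (localCohomologyCoconeIsColimit a i X) (i := op (op n)) (j := op (op n)) x 0
      (h0.trans (map_zero ((localCohomologyCocone a i X).ι.app (op (op n))).hom).symm)
    refine ⟨k.unop.unop, f.unop.unop.le, ?_⟩
    rw [← extModuleLinearEquiv_system_map]
    have : ((localCohomologySystem a i X).map f).hom x = 0 := hk.trans (map_zero _)
    exact (congrArg _ this).trans (map_zero _)
  · rintro ⟨m, h, h0⟩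
    rw [← localCohomologyι_extRestrict a i X h, h0, map_zero]

/-- A compatible family of maps out of the modules `Ext^i(R / a ^ n, X)` induces a map out of the
local cohomology module, which agrees with the family on each of them. -/
lemma exists_localCohomology_desc {Z : Type u} [AddCommGroup Z] [Module R Z]
    (f : ∀ n, Abelian.Ext (powQuotient a n) X i →ₗ[R] Z)
    (hf : ∀ {n m : ℕ} (h : n ≤ m) (ξ), f m (extRestrict a i X h ξ) = f n ξ) :
    ∃ F : localCohomologyModule a i X →ₗ[R] Z, ∀ n ξ, F (localCohomologyι a i X n ξ) = f n ξ := by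
  let c : Limits.Cocone (localCohomologySystem a i X) :=
    { pt := ModuleCat.of R Z
      ι :=
        { app := fun n => ModuleCat.ofHom
            (f n.unop.unop ∘ₗ (extModuleLinearEquiv (powQuotient a n.unop.unop) X i).toLinearMap)
          naturality := fun n m g => by
            ext x
            have h := extModuleLinearEquiv_system_map a i X g.unop.unop.le x
            refine Eq.trans ?_ (hf g.unop.unop.le _)
            exact congrArg (f m.unop.unop) h } }
  refine ⟨((localCohomologyCoconeIsColimit a i X).desc c).hom, fun n ξ => ?_⟩
  obtain ⟨x, rfl⟩ := (extModuleLinearEquiv (powQuotient a n) X i).surjective ξ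
  rw [localCohomologyι_extModuleLinearEquiv]
  exact ConcreteCategory.congr_hom
    ((localCohomologyCoconeIsColimit a i X).fac c (op (op n))) x

/-- Every class in `Ext^i(R / a ^ n, X)` restricts to zero on `R / a ^ m` for some `m ≥ n`. -/
def ExtEventuallyZero : Prop :=
  ∀ n (ξ : Abelian.Ext (powQuotient a n) X i), ∃ m, ∃ h : n ≤ m, extRestrict a i X h ξ = 0

/-- Lets vanishing of local cohomology be proved by restricting individual classes, with no colimit
in sight. -/
lemma extEventuallyZero_iff :
    ExtEventuallyZero a i X ↔ Subsingleton (localCohomologyModule a i X) := by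
  constructor
  · intro h
    refine subsingleton_of_forall_eq 0 fun x => ?_
    obtain ⟨n, ξ, rfl⟩ := exists_localCohomologyι_eq a i X x
    exact (localCohomologyι_eq_zero_iff a i X n ξ).2 (h n ξ)
  · intro h n ξ
    exact (localCohomologyι_eq_zero_iff a i X n ξ).1 (Subsingleton.elim _ _)

end LocalCohomologyElements

/-! ### Torsion submodules and injective modules over a Noetherian ring. -/

section IdealTorsion

variable {R : Type u} [CommRing R] (a : Ideal R)

lemma idealTorsion_idealTorsion (X : Type u) [AddCommGroup X] [Module R X] :
    idealTorsion a (idealTorsion a X) = ⊤ := by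
  refine eq_top_iff.2 fun x _ => ?_
  obtain ⟨n, hn⟩ := x.2
  exact ⟨n, fun r hr => Subtype.ext (hn r hr)⟩

lemma idealTorsion_eq_top_of_surjective {X Y : Type u} [AddCommGroup X] [Module R X]
    [AddCommGroup Y] [Module R Y] (f : X →ₗ[R] Y) (hf : Function.Surjective f)
    (hX : idealTorsion a X = ⊤) : idealTorsion a Y = ⊤ := by
  refine eq_top_iff.2 fun y _ => ?_
  obtain ⟨x, rfl⟩ := hf y
  obtain ⟨n, hn⟩ : x ∈ idealTorsion a X := hX ▸ Submodule.mem_top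
  exact ⟨n, fun r hr => by rw [← map_smul, hn r hr, map_zero]⟩

lemma map_mem_idealTorsion {X Y : Type u} [AddCommGroup X] [Module R X]
    [AddCommGroup Y] [Module R Y] (f : X →ₗ[R] Y) {x : X} (hx : x ∈ idealTorsion a X) :
    f x ∈ idealTorsion a Y := by
  obtain ⟨n, hn⟩ := hx
  exact ⟨n, fun r hr => by rw [← map_smul, hn r hr, map_zero]⟩

lemma exists_pow_smul_eq_zero_of_fg {X : Type u} [AddCommGroup X] [Module R X]
    {N : Submodule R X} (hN : N.FG) (h : N ≤ idealTorsion a X) :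
    ∃ n : ℕ, ∀ r ∈ a ^ n, ∀ x ∈ N, r • x = 0 := by
  induction N, hN using Submodule.fg_induction with
  | singleton x =>
    obtain ⟨n, hn⟩ := h (Submodule.mem_span_singleton_self x)
    refine ⟨n, fun r hr y hy => ?_⟩
    obtain ⟨c, rfl⟩ := Submodule.mem_span_singleton.1 hy
    rw [smul_comm, hn r hr, smul_zero]
  | sup N₁ N₂ _ _ h₁ h₂ =>
    obtain ⟨n₁, h₁⟩ := h₁ (le_sup_left.trans h)
    obtain ⟨n₂, h₂⟩ := h₂ (le_sup_right.trans h)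
    refine ⟨max n₁ n₂, fun r hr x hx => ?_⟩
    obtain ⟨y, hy, z, hz, rfl⟩ := Submodule.mem_sup.1 hx
    rw [smul_add, h₁ r (Ideal.pow_le_pow_right (le_max_left _ _) hr) y hy,
      h₂ r (Ideal.pow_le_pow_right (le_max_right _ _) hr) z hz, add_zero]

/-- The submodule a^n x is finitely generated and torsion, so a single a^m kills it; then a^(m+n)
kills x. -/
lemma mem_idealTorsion_of_pow_smul_mem [IsNoetherianRing R] {X : Type u} [AddCommGroup X]
    [Module R X] {x : X} (n : ℕ) (h : ∀ r ∈ a ^ n, r • x ∈ idealTorsion a X) :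
    x ∈ idealTorsion a X := by
  have hfg : (Submodule.map (LinearMap.toSpanSingleton R X x) (a ^ n)).FG :=
    Submodule.FG.map _ (IsNoetherian.noetherian _)
  obtain ⟨m, hm⟩ := exists_pow_smul_eq_zero_of_fg a hfg (by
    rintro _ ⟨r, hr, rfl⟩
    exact h r hr)
  refine ⟨m + n, fun r hr => ?_⟩
  rw [pow_add] at hr
  refine Submodule.mul_induction_on hr (fun s hs t ht => ?_) fun s t hs ht => ?_
  · rw [mul_smul]
    exact hm s hs _ ⟨t, ht, rfl⟩
  · rw [add_smul, hs, ht, add_zero]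

lemma idealTorsion_quotient_idealTorsion [IsNoetherianRing R] (X : Type u) [AddCommGroup X]
    [Module R X] : idealTorsion a (X ⧸ idealTorsion a X) = ⊥ := by
  refine eq_bot_iff.2 fun x hx => ?_
  obtain ⟨x, rfl⟩ := Submodule.mkQ_surjective _ x
  obtain ⟨n, hn⟩ := hx
  refine (Submodule.mem_bot R).2 ((Submodule.Quotient.mk_eq_zero _).2 ?_)
  refine mem_idealTorsion_of_pow_smul_mem a n fun r hr => ?_
  rw [← Submodule.Quotient.mk_eq_zero]
  exact hn r hr

/-- The torsion submodule of an injective module over a Noetherian ring is injective. -/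
lemma injective_idealTorsion [IsNoetherianRing R] (E : Type u) [AddCommGroup E] [Module R E]
    [hE : Module.Injective R E] : Module.Injective R (idealTorsion a E) := by
  -- Baer's criterion: the image of `g` is killed by some a^m, and Artin–Rees gives k with I ∩
  -- a^(m+k) ⊆ a^m I, so `g` vanishes on I ∩ a^(m+k).
  refine Module.Baer.injective fun I g => ?_
  obtain ⟨m, hm⟩ := exists_pow_smul_eq_zero_of_fg a
    (N := LinearMap.range ((idealTorsion a E).subtype ∘ₗ g))
    (Module.Finite.fg_top.map _ |> fun h => by rwa [LinearMap.range_eq_map])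
    (by rintro _ ⟨x, rfl⟩; exact (g x).2)
  obtain ⟨k, hk⟩ := Ideal.exists_pow_inf_eq_pow_smul (M := R) a I
  have hI : ∀ x : I, (x : R) ∈ a ^ (m + k) → g x = 0 := by
    have hle : a ^ m • (a ^ k • ⊤ ⊓ I : Submodule R R) ≤
        Submodule.map I.subtype (LinearMap.ker g) := by
      refine Submodule.smul_le.2 fun r hr y hy => ⟨r • ⟨y, hy.2⟩, ?_, rfl⟩
      refine Subtype.ext ?_
      rw [map_smul]
      exact hm r hr _ ⟨⟨y, hy.2⟩, rfl⟩
    intro x hx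
    have hx' : (x : R) ∈ (a ^ (m + k) • ⊤ ⊓ I : Submodule R R) :=
      ⟨by simpa using hx, x.2⟩
    rw [hk _ (Nat.le_add_left _ _), Nat.add_sub_cancel] at hx'
    obtain ⟨y, hy, hxy⟩ := hle hx'
    obtain rfl : y = x := Subtype.ext hxy
    exact hy
  -- So `g` factors through I/(I ∩ a^(m+k)), a submodule of R/a^(m+k). An extension of it to
  -- R/a^(m+k) has values killed by a^(m+k), hence torsion.
  let φ : I →ₗ[R] R ⧸ a ^ (m + k) := (a ^ (m + k)).mkQ ∘ₗ I.subtype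
  obtain ⟨h, hh⟩ := hE.out ((LinearMap.ker φ).liftQ φ le_rfl)
    (LinearMap.ker_eq_bot.1 (Submodule.ker_liftQ_eq_bot' _ _ rfl))
    ((LinearMap.ker φ).liftQ ((idealTorsion a E).subtype ∘ₗ g) (fun x hx => by
      have hx' : (x : R) ∈ a ^ (m + k) := (Submodule.Quotient.mk_eq_zero _).1 hx
      simp [hI x hx']))
  refine ⟨(h ∘ₗ (a ^ (m + k)).mkQ).codRestrict _ fun x => ?_, fun x hx => Subtype.ext ?_⟩
  · refine ⟨m + k, fun r hr => ?_⟩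
    have h0 : (a ^ (m + k)).mkQ (r • x) = 0 :=
      (Submodule.Quotient.mk_eq_zero _).2 ((a ^ (m + k)).mul_mem_right x hr)
    rw [← map_smul, LinearMap.comp_apply, h0, map_zero]
  · exact hh (Submodule.Quotient.mk ⟨x, hx⟩)

/-- The quotient of an injective module over a Noetherian ring by its torsion submodule is
injective. -/
lemma injective_quotient_idealTorsion [IsNoetherianRing R] (E : Type u) [AddCommGroup E]
    [Module R E] [hE : Module.Injective R E] : Module.Injective R (E ⧸ idealTorsion a E) := by
  obtain ⟨ρ, hρ⟩ := (injective_idealTorsion a E).out (idealTorsion a E).subtype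
    (Submodule.subtype_injective _) LinearMap.id
  -- The torsion submodule has a retraction `ρ`, so id - ρ descends to a section of the projection:
  -- the quotient is a retract of E.
  let s : (E ⧸ idealTorsion a E) →ₗ[R] E := (idealTorsion a E).liftQ
    (LinearMap.id - (idealTorsion a E).subtype ∘ₗ ρ) (fun x hx => by
      have := congrArg Subtype.val (hρ ⟨x, hx⟩)
      simpa [sub_eq_zero] using this.symm)
  have hs : ∀ x, (idealTorsion a E).mkQ (s x) = x := by
    intro x
    obtain ⟨x, rfl⟩ := Submodule.mkQ_surjective _ x
    simp [s]
  refine ⟨fun X Y _ _ _ _ f hf g => ?_⟩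
  obtain ⟨h, hh⟩ := hE.out f hf (s ∘ₗ g)
  exact ⟨(idealTorsion a E).mkQ ∘ₗ h, fun x => by
    rw [LinearMap.comp_apply, hh, LinearMap.comp_apply, hs]⟩

/-- Every module embeds in an injective module. -/
lemma exists_injective_embedding (X : Type u) [AddCommGroup X] [Module R X] :
    ∃ (E : Type u) (_ : AddCommGroup E) (_ : Module R E) (f : X →ₗ[R] E),
      Module.Injective R E ∧ Function.Injective f :=
  let E : ModuleCat.{u} R := Injective.under (ModuleCat.of R X)
  have : Injective (ModuleCat.of R E) := Injective.injective_under (ModuleCat.of R X)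
  ⟨E, inferInstance, inferInstance, (Injective.ι (ModuleCat.of R X)).hom,
    Module.injective_module_of_injective_object R E,
    (ModuleCat.mono_iff_injective _).1 (Injective.ι_mono (ModuleCat.of R X))⟩

lemma exists_torsion_injective_embedding [IsNoetherianRing R] (X : Type u) [AddCommGroup X]
    [Module R X] (hX : idealTorsion a X = ⊤) :
    ∃ (E : Type u) (_ : AddCommGroup E) (_ : Module R E) (f : X →ₗ[R] E),
      Module.Injective R E ∧ idealTorsion a E = ⊤ ∧ Function.Injective f := by
  obtain ⟨E, _, _, f, hE, hf⟩ := exists_injective_embedding (R := R) X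
  refine ⟨idealTorsion a E, inferInstance, inferInstance,
    f.codRestrict _ fun x => map_mem_idealTorsion a f (hX ▸ Submodule.mem_top),
    injective_idealTorsion a E, idealTorsion_idealTorsion a E, fun x y h => hf ?_⟩
  exact congrArg Subtype.val h

/-- Embed X in an injective E and pass to E/Γ(E): the kernel of the composite is X ∩ Γ(E), which
lies in Γ(X) = 0. -/
lemma exists_torsionFree_injective_embedding [IsNoetherianRing R] (X : Type u) [AddCommGroup X]
    [Module R X] (hX : idealTorsion a X = ⊥) :
    ∃ (E : Type u) (_ : AddCommGroup E) (_ : Module R E) (f : X →ₗ[R] E),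
      Module.Injective R E ∧ idealTorsion a E = ⊥ ∧ Function.Injective f := by
  obtain ⟨E, _, _, f, hE, hf⟩ := exists_injective_embedding (R := R) X
  refine ⟨E ⧸ idealTorsion a E, inferInstance, inferInstance, (idealTorsion a E).mkQ ∘ₗ f,
    injective_quotient_idealTorsion a E, idealTorsion_quotient_idealTorsion a E, ?_⟩
  refine (injective_iff_map_eq_zero _).2 fun x hx => ?_
  obtain ⟨n, hn⟩ := (Submodule.Quotient.mk_eq_zero _).1 hx
  have hx' : x ∈ idealTorsion a X := ⟨n, fun r hr => hf (by rw [map_smul, hn r hr, map_zero])⟩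
  rwa [hX] at hx'

lemma support_subset_zeroLocus_of_idealTorsion_eq_top (X : Type u) [AddCommGroup X] [Module R X]
    (hX : idealTorsion a X = ⊤) :
    Module.support R X ⊆ PrimeSpectrum.zeroLocus (a : Set R) := by
  intro p hp
  obtain ⟨x, hx⟩ := Module.mem_support_iff_exists_annihilator.1 hp
  obtain ⟨n, hn⟩ : x ∈ idealTorsion a X := hX ▸ Submodule.mem_top
  refine p.2.le_of_pow_le (n := n) fun r hr => hx ?_
  rw [Submodule.mem_annihilator_span_singleton]
  exact hn r hr

end IdealTorsion

/-! ### Dimension shifting and vanishing of Ext and local cohomology. -/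

section ExtVanishing

variable {R : Type u} [CommRing R] (a : Ideal R)

/-- The short exact sequence defined by a submodule. -/
abbrev submoduleShortComplex {X : Type u} [AddCommGroup X] [Module R X] (N : Submodule R X) :
    ShortComplex (ModuleCat.{u} R) :=
  ShortComplex.mk (ModuleCat.ofHom N.subtype) (ModuleCat.ofHom N.mkQ) (by
    ext x
    exact (Submodule.Quotient.mk_eq_zero _).2 x.2)

lemma submoduleShortComplex_shortExact {X : Type u} [AddCommGroup X] [Module R X]
    (N : Submodule R X) : (submoduleShortComplex N).ShortExact where
  exact := by
    rw [ShortComplex.moduleCat_exact_iff]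
    exact fun x hx => ⟨⟨x, (Submodule.Quotient.mk_eq_zero _).1 hx⟩, rfl⟩
  mono_f := (ModuleCat.mono_iff_injective _).2 (Submodule.subtype_injective N)
  epi_g := (ModuleCat.epi_iff_surjective _).2 (Submodule.mkQ_surjective N)

/-- The short exact sequence defined by an injective linear map. -/
abbrev cokernelShortComplex {X E : Type u} [AddCommGroup X] [Module R X] [AddCommGroup E]
    [Module R E] (f : X →ₗ[R] E) : ShortComplex (ModuleCat.{u} R) :=
  ShortComplex.mk (ModuleCat.ofHom f) (ModuleCat.ofHom (LinearMap.range f).mkQ) (by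
    ext x
    exact (Submodule.Quotient.mk_eq_zero _).2 ⟨x, rfl⟩)

lemma cokernelShortComplex_shortExact {X E : Type u} [AddCommGroup X] [Module R X]
    [AddCommGroup E] [Module R E] {f : X →ₗ[R] E} (hf : Function.Injective f) :
    (cokernelShortComplex f).ShortExact where
  exact := by
    rw [ShortComplex.moduleCat_exact_iff]
    exact fun x hx => (Submodule.Quotient.mk_eq_zero _).1 hx
  mono_f := (ModuleCat.mono_iff_injective _).2 hf
  epi_g := (ModuleCat.epi_iff_surjective _).2 (Submodule.mkQ_surjective _)

/-- The morphism `R / a ^ n ⟶ X` given by an element of `X` killed by `a ^ n`. -/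
def powQuotientDesc {n : ℕ} {X : ModuleCat.{u} R} (x : X) (hx : ∀ r ∈ a ^ n, r • x = 0) :
    powQuotient a n ⟶ X :=
  ModuleCat.ofHom (Submodule.liftQ (a ^ n) (LinearMap.toSpanSingleton R X x) hx)

lemma powQuotientDesc_one {n : ℕ} {X : ModuleCat.{u} R} (x : X) (hx : ∀ r ∈ a ^ n, r • x = 0) :
    (powQuotientDesc a x hx).hom (1 : R ⧸ a ^ n) = x :=
  one_smul R x

lemma powQuotient_hom_ext {n : ℕ} {X : ModuleCat.{u} R} {f g : powQuotient a n ⟶ X}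
    (h : f.hom (1 : R ⧸ a ^ n) = g.hom (1 : R ⧸ a ^ n)) : f = g := by
  ext
  exact h

lemma pow_smul_powQuotient {n : ℕ} {r : R} (hr : r ∈ a ^ n) (x : powQuotient a n) :
    r • x = 0 := by
  obtain ⟨s, rfl⟩ := Ideal.Quotient.mk_surjective x
  exact Ideal.Quotient.eq_zero_iff_mem.2 ((a ^ n).mul_mem_right s hr)

lemma extRestrict_comp {n m : ℕ} (h : n ≤ m) {i j k : ℕ} {X Y : ModuleCat.{u} R}
    (ξ : Abelian.Ext (powQuotient a n) X i) (α : Abelian.Ext X Y j) (hk : i + j = k) :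
    extRestrict a k Y h (ξ.comp α hk) = (extRestrict a i X h ξ).comp α hk :=
  (Abelian.Ext.comp_assoc _ _ _ (zero_add i) hk (by lia)).symm

lemma extRestrict_extRestrict {n m k : ℕ} (h : n ≤ m) (h' : m ≤ k) {i : ℕ} {X : ModuleCat.{u} R}
    (ξ : Abelian.Ext (powQuotient a n) X i) :
    extRestrict a i X h' (extRestrict a i X h ξ) = extRestrict a i X (h.trans h') ξ := by
  simp only [extRestrict_apply]
  rw [← powQuotientMap_comp a h h', ← Abelian.Ext.mk₀_comp_mk₀_assoc]

/-- Evaluation at `1` of a class in `Ext^0(R / a ^ n, X) = Hom(R / a ^ n, X)`. -/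
def extEvalOne (X : ModuleCat.{u} R) (n : ℕ) : Abelian.Ext (powQuotient a n) X 0 →ₗ[R] X :=
  LinearMap.applyₗ (R := R) (1 : R ⧸ a ^ n) ∘ₗ
    (Abelian.Ext.linearEquiv₀ (R := R).trans ModuleCat.homLinearEquiv).toLinearMap

lemma extEvalOne_mk₀ {X : ModuleCat.{u} R} {n : ℕ} (f : powQuotient a n ⟶ X) :
    extEvalOne a X n (Abelian.Ext.mk₀ f) = f.hom (1 : R ⧸ a ^ n) := by
  have : Abelian.Ext.linearEquiv₀ (R := R) (Abelian.Ext.mk₀ f) = f :=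
    Abelian.Ext.addEquiv₀.apply_symm_apply f
  simp only [extEvalOne, LinearMap.comp_apply, LinearEquiv.coe_coe, LinearEquiv.trans_apply, this]
  rfl

lemma exists_mk₀_eq {X Y : ModuleCat.{u} R} (ξ : Abelian.Ext X Y 0) :
    ∃ f : X ⟶ Y, Abelian.Ext.mk₀ f = ξ :=
  Abelian.Ext.addEquiv₀.symm.surjective ξ

lemma extEvalOne_extRestrict {X : ModuleCat.{u} R} {n m : ℕ} (h : n ≤ m)
    (ξ : Abelian.Ext (powQuotient a n) X 0) :
    extEvalOne a X m (extRestrict a 0 X h ξ) = extEvalOne a X n ξ := by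
  obtain ⟨f, rfl⟩ := exists_mk₀_eq ξ
  rw [extRestrict_apply, Abelian.Ext.mk₀_comp_mk₀, extEvalOne_mk₀, extEvalOne_mk₀]
  rfl

lemma extEvalOne_injective (X : ModuleCat.{u} R) (n : ℕ) :
    Function.Injective (extEvalOne a X n) := by
  intro ξ η h
  obtain ⟨f, rfl⟩ := exists_mk₀_eq ξ
  obtain ⟨g, rfl⟩ := exists_mk₀_eq η
  rw [extEvalOne_mk₀, extEvalOne_mk₀] at h
  rw [powQuotient_hom_ext a h]

lemma extEvalOne_mem_idealTorsion {X : ModuleCat.{u} R} {n : ℕ}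
    (ξ : Abelian.Ext (powQuotient a n) X 0) : extEvalOne a X n ξ ∈ idealTorsion a X := by
  obtain ⟨f, rfl⟩ := exists_mk₀_eq ξ
  rw [extEvalOne_mk₀]
  exact ⟨n, fun r hr => by rw [← map_smul, pow_smul_powQuotient a hr, map_zero]⟩

lemma exists_extEvalOne_eq {X : ModuleCat.{u} R} {x : X} (hx : x ∈ idealTorsion a X) :
    ∃ n, ∃ ξ : Abelian.Ext (powQuotient a n) X 0, extEvalOne a X n ξ = x := by
  obtain ⟨n, hn⟩ := hx
  exact ⟨n, Abelian.Ext.mk₀ (powQuotientDesc a x hn), by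
    rw [extEvalOne_mk₀, powQuotientDesc_one]⟩

/-- If `Ext^0(R / a ^ n, X)` is eventually zero then `X` is torsion-free. -/
lemma ExtEventuallyZero.idealTorsion_eq_bot {X : ModuleCat.{u} R} (h : ExtEventuallyZero a 0 X) :
    idealTorsion a X = ⊥ := by
  refine eq_bot_iff.2 fun x hx => ?_
  obtain ⟨n, ξ, rfl⟩ := exists_extEvalOne_eq a hx
  obtain ⟨m, hm, h0⟩ := h n ξ
  rw [← extEvalOne_extRestrict a hm, h0, map_zero]
  exact Submodule.zero_mem _

lemma subsingleton_ext_zero_of_torsionFree {M E : ModuleCat.{u} R} (n : ℕ)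
    (hM : ∀ r ∈ a ^ n, ∀ x : M, r • x = 0) (hE : idealTorsion a E = ⊥) :
    Subsingleton (Abelian.Ext M E 0) := by
  refine subsingleton_of_forall_eq 0 fun ξ => ?_
  obtain ⟨f, rfl⟩ := exists_mk₀_eq ξ
  have hf : f = 0 := by
    ext x
    have hx : f.hom x ∈ idealTorsion a E :=
      ⟨n, fun r hr => by rw [← map_smul, hM r hr, map_zero]⟩
    rw [hE] at hx
    exact hx
  rw [hf, Abelian.Ext.mk₀_zero]

/-- Injectivity kills positive degrees; in degree 0, a map from M has torsion image. -/
lemma subsingleton_ext_of_torsionFree_injective {M E : ModuleCat.{u} R} (n : ℕ)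
    (hM : ∀ r ∈ a ^ n, ∀ x : M, r • x = 0) (hE : idealTorsion a E = ⊥)
    [Module.Injective R E] (i : ℕ) : Subsingleton (Abelian.Ext M E i) := by
  have : Injective E := Module.injective_object_of_injective_module R E
  cases i with
  | zero => exact subsingleton_ext_zero_of_torsionFree a n hM hE
  | succ i => exact Abelian.Ext.subsingleton_of_injective M E i

/-- Dimension shifting along a short exact sequence whose middle term has no `Ext`. -/
def extShift {S : ShortComplex (ModuleCat.{u} R)} (hS : S.ShortExact) {M : ModuleCat.{u} R}
    (h : ∀ i, Subsingleton (Abelian.Ext M S.X₂ i)) (i : ℕ) :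
    Abelian.Ext M S.X₃ i ≃ₗ[R] Abelian.Ext M S.X₁ (i + 1) :=
  LinearEquiv.ofBijective (hS.extClass.postcompOfLinear R M rfl) (by
    constructor
    · refine (injective_iff_map_eq_zero _).2 fun ξ hξ => ?_
      obtain ⟨η, rfl⟩ := Abelian.Ext.covariant_sequence_exact₃ M hS ξ rfl hξ
      rw [(h i).elim η 0, Abelian.Ext.zero_comp]
    · intro ξ
      exact Abelian.Ext.covariant_sequence_exact₁ M hS ξ ((h (i + 1)).elim _ _) rfl)

/-- If `Ext(M, S.X₃)` vanishes, then `Ext(M, S.X₁)` and `Ext(M, S.X₂)` agree. -/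
def extLinearEquivOfSubsingleton {S : ShortComplex (ModuleCat.{u} R)} (hS : S.ShortExact)
    {M : ModuleCat.{u} R} (h : ∀ i, Subsingleton (Abelian.Ext M S.X₃ i)) (i : ℕ) :
    Abelian.Ext M S.X₁ i ≃ₗ[R] Abelian.Ext M S.X₂ i :=
  LinearEquiv.ofBijective ((Abelian.Ext.mk₀ S.f).postcompOfLinear R M (add_zero i)) (by
    constructor
    · cases i with
      -- No term precedes degree 0 in the long exact sequence; injectivity comes from `S.f` being
      -- mono.
      | zero =>
        have := hS.mono_f
        exact Abelian.Ext.postcomp_mk₀_injective_of_mono M S.f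
      | succ i =>
        refine (injective_iff_map_eq_zero _).2 fun ξ hξ => ?_
        obtain ⟨η, rfl⟩ := Abelian.Ext.covariant_sequence_exact₁ M hS ξ hξ rfl
        rw [(h i).elim η 0, Abelian.Ext.zero_comp]
    · intro ξ
      exact Abelian.Ext.covariant_sequence_exact₂ M hS ξ ((h i).elim _ _))

/-- The higher local cohomology of a torsion module vanishes. -/
lemma extEventuallyZero_succ_of_torsion [IsNoetherianRing R] (i : ℕ) (X : ModuleCat.{u} R)
    (hX : idealTorsion a X = ⊤) : ExtEventuallyZero a (i + 1) X := by
  induction i generalizing X with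
  | zero =>
    intro n ξ
    obtain ⟨E, _, _, f, hE, hET, hf⟩ := exists_torsion_injective_embedding a X hX
    have hS := cokernelShortComplex_shortExact hf
    have : Injective (ModuleCat.of R E) := Module.injective_object_of_injective_module R E
    obtain ⟨η, rfl⟩ := Abelian.Ext.covariant_sequence_exact₁ _ hS ξ
      (Abelian.Ext.eq_zero_of_injective _) rfl
    obtain ⟨g, rfl⟩ := exists_mk₀_eq η
    -- The class is the connecting image of g : R/a^n ⟶ E/X. As E is torsion, a lift `e` of g(1) is
    -- killed by some a^m, so g restricted to R/a^(max n m) lifts to E and its connecting image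
    -- vanishes.
    obtain ⟨e, he⟩ := Submodule.mkQ_surjective _ (g.hom (1 : R ⧸ a ^ n))
    obtain ⟨m, hm⟩ : e ∈ idealTorsion a E := hET ▸ Submodule.mem_top
    refine ⟨max n m, le_max_left _ _, ?_⟩
    let d : powQuotient a (max n m) ⟶ ModuleCat.of R E := powQuotientDesc a e fun r hr =>
      hm r (Ideal.pow_le_pow_right (le_max_right _ _) hr)
    have hd : powQuotientMap a (le_max_left n m) ≫ g = d ≫ (cokernelShortComplex f).g := by
      refine powQuotient_hom_ext a ?_
      refine Eq.trans he.symm ?_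
      exact congrArg (LinearMap.range f).mkQ
        (powQuotientDesc_one (X := ModuleCat.of R E) a e _).symm
    rw [extRestrict_comp, extRestrict_apply, Abelian.Ext.mk₀_comp_mk₀, hd,
      ← Abelian.Ext.mk₀_comp_mk₀, Abelian.Ext.comp_assoc _ _ _ (zero_add 0) (zero_add 1) (by lia),
      hS.comp_extClass, Abelian.Ext.comp_zero]
  | succ i ih =>
    intro n ξ
    obtain ⟨E, _, _, f, hE, hET, hf⟩ := exists_torsion_injective_embedding a X hX
    have hS := cokernelShortComplex_shortExact hf
    have : Injective (ModuleCat.of R E) := Module.injective_object_of_injective_module R E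
    obtain ⟨η, rfl⟩ := Abelian.Ext.covariant_sequence_exact₁ _ hS ξ
      (Abelian.Ext.eq_zero_of_injective _) rfl
    -- The cokernel E/X is again torsion, so the induction hypothesis applies to it one degree
    -- lower.
    obtain ⟨m, hm, h0⟩ := ih (ModuleCat.of R (E ⧸ LinearMap.range f))
      (idealTorsion_eq_top_of_surjective a _ (Submodule.mkQ_surjective _) hET) n η
    exact ⟨m, hm, by rw [extRestrict_comp, h0, Abelian.Ext.zero_comp]⟩

/-- Exactness of H^i(X₂) → H^i(X₃) → H^{i+1}(X₁) on representatives: one restriction kills the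
connecting image, a second kills the resulting lift to X₂. -/
lemma ExtEventuallyZero.of_shortExact {S : ShortComplex (ModuleCat.{u} R)} (hS : S.ShortExact)
    {i : ℕ} (h₂ : ExtEventuallyZero a i S.X₂) (h₁ : ExtEventuallyZero a (i + 1) S.X₁) :
    ExtEventuallyZero a i S.X₃ := by
  intro n ξ
  obtain ⟨m, hm, h0⟩ := h₁ n (ξ.comp hS.extClass rfl)
  rw [extRestrict_comp] at h0
  obtain ⟨η, hη⟩ := Abelian.Ext.covariant_sequence_exact₃ _ hS _ rfl h0
  obtain ⟨k, hk, h0'⟩ := h₂ m η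
  refine ⟨k, hm.trans hk, ?_⟩
  rw [← extRestrict_extRestrict a hm hk, ← hη, extRestrict_comp, h0', Abelian.Ext.zero_comp]

/-- The quotient by the torsion submodule keeps the vanishing of higher local cohomology. -/
lemma ExtEventuallyZero.quotient_idealTorsion [IsNoetherianRing R] {X : ModuleCat.{u} R} {i : ℕ}
    (h : ExtEventuallyZero a i X) :
    ExtEventuallyZero a i (ModuleCat.of R (X ⧸ idealTorsion a X)) :=
  ExtEventuallyZero.of_shortExact a (submoduleShortComplex_shortExact (idealTorsion a X)) h
    (extEventuallyZero_succ_of_torsion a i _ (idealTorsion_idealTorsion a X))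

lemma ExtEventuallyZero.of_succ {S : ShortComplex (ModuleCat.{u} R)} (hS : S.ShortExact)
    (hE : idealTorsion a S.X₂ = ⊥) [Module.Injective R S.X₂] {i : ℕ}
    (h : ExtEventuallyZero a (i + 1) S.X₁) : ExtEventuallyZero a i S.X₃ := by
  refine ExtEventuallyZero.of_shortExact a hS (fun n ξ => ⟨n, le_rfl, ?_⟩) h
  exact (subsingleton_ext_of_torsionFree_injective a n
    (fun _ hr => pow_smul_powQuotient a hr) hE i).elim _ _

/-- A torsion-free module without local cohomology has no `Ext` from modules killed by a power of
the ideal. -/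
lemma subsingleton_ext_of_extEventuallyZero [IsNoetherianRing R] {M : ModuleCat.{u} R} (n : ℕ)
    (hM : ∀ r ∈ a ^ n, ∀ x : M, r • x = 0) (i : ℕ) (X : ModuleCat.{u} R)
    (hX : idealTorsion a X = ⊥) (h : ∀ j, ExtEventuallyZero a (j + 1) X) :
    Subsingleton (Abelian.Ext M X i) := by
  induction i generalizing X with
  | zero => exact subsingleton_ext_zero_of_torsionFree a n hM hX
  | succ i ih =>
    obtain ⟨E, _, _, f, hE, hET, hf⟩ := exists_torsionFree_injective_embedding a X hX
    have hS := cokernelShortComplex_shortExact hf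
    have hE' : Module.Injective R (cokernelShortComplex f).X₂ := hE
    -- Shifting lowers the vanishing range to j ≥ 0: degree 0 makes the cokernel torsion-free and
    -- the other degrees renew the hypothesis, so the induction applies to it.
    have hC (j : ℕ) : ExtEventuallyZero a j (cokernelShortComplex f).X₃ :=
      ExtEventuallyZero.of_succ a hS hET (h j)
    have := ih _ (hC 0).idealTorsion_eq_bot fun j => hC (j + 1)
    exact (extShift hS (subsingleton_ext_of_torsionFree_injective a (E := ModuleCat.of R E)
      n hM hET) i).symm.toEquiv.subsingleton

end ExtVanishing

/-! ### The first local cohomology module as a torsion submodule, and cofiniteness. -/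

section Cofiniteness

variable {R : Type u} [CommRing R] (a : Ideal R)

/-- Each class comes from some Ext^i(R/a^n, X), where scalars act through R/a^n. -/
lemma idealTorsion_localCohomologyModule (i : ℕ) (X : ModuleCat.{u} R) :
    idealTorsion a (localCohomologyModule a i X) = ⊤ := by
  refine eq_top_iff.2 fun x _ => ?_
  obtain ⟨n, ξ, rfl⟩ := exists_localCohomologyι_eq a i X x
  refine ⟨n, fun r hr => ?_⟩
  have h0 : r • 𝟙 (powQuotient a n) = 0 := by
    ext
    exact pow_smul_powQuotient a hr (1 : R ⧸ a ^ n)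
  have h1 : r • ξ = 0 := by
    rw [← Abelian.Ext.mk₀_id_comp ξ, ← Abelian.Ext.smul_comp, ← Abelian.Ext.mk₀_smul, h0,
      Abelian.Ext.mk₀_zero, Abelian.Ext.zero_comp]
  rw [← map_smul, h1, map_zero]

/-- The zeroth local cohomology module of `X` embeds in `X`. -/
lemma exists_localCohomologyModule_zero_injective (X : ModuleCat.{u} R) :
    ∃ F : localCohomologyModule a 0 X →ₗ[R] X, Function.Injective F := by
  obtain ⟨F, hF⟩ := exists_localCohomology_desc a 0 X (extEvalOne a X)
    (fun h ξ => extEvalOne_extRestrict a h ξ)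
  refine ⟨F, (injective_iff_map_eq_zero _).2 fun x hx => ?_⟩
  obtain ⟨n, ξ, rfl⟩ := exists_localCohomologyι_eq a 0 X x
  rw [hF] at hx
  rw [extEvalOne_injective a X n (hx.trans (map_zero _).symm), map_zero]

/-- If the torsion-free quotient of `X` embeds in a torsion-free injective module with cokernel
`N`, then the first local cohomology module of `X` is the torsion submodule of `N`. -/
lemma nonempty_localCohomologyModule_one_equiv [IsNoetherianRing R] (X : ModuleCat.{u} R)
    {E : Type u} [AddCommGroup E] [Module R E] [Module.Injective R E]
    (hE : idealTorsion a E = ⊥) (f : (X ⧸ idealTorsion a X) →ₗ[R] E)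
    (hf : Function.Injective f) :
    Nonempty (localCohomologyModule a 1 X ≃ₗ[R] idealTorsion a (E ⧸ LinearMap.range f)) := by
  have hT := submoduleShortComplex_shortExact (idealTorsion a X)
  have hS := cokernelShortComplex_shortExact hf
  let π : X ⟶ ModuleCat.of R (X ⧸ idealTorsion a X) :=
    (submoduleShortComplex (idealTorsion a X)).g
  let N : ModuleCat.{u} R := (cokernelShortComplex f).X₃
  let δ (n : ℕ) : Abelian.Ext (powQuotient a n) N 0 ≃ₗ[R]
      Abelian.Ext (powQuotient a n) (ModuleCat.of R (X ⧸ idealTorsion a X)) 1 :=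
    extShift hS (subsingleton_ext_of_torsionFree_injective a (E := ModuleCat.of R E) n
      (fun _ hr => pow_smul_powQuotient a hr) hE) 0
  let p (n : ℕ) := (Abelian.Ext.mk₀ π).postcompOfLinear R (powQuotient a n) (add_zero 1)
  have hδ {n m : ℕ} (h : n ≤ m) (ξ) : (δ m).symm (extRestrict a 1 _ h ξ) =
      extRestrict a 0 N h ((δ n).symm ξ) := by
    rw [LinearEquiv.symm_apply_eq]
    obtain ⟨η, rfl⟩ := (δ n).surjective ξ
    rw [LinearEquiv.symm_apply_apply]
    exact extRestrict_comp a h η hS.extClass rfl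
  have hp {n m : ℕ} (h : n ≤ m) (ξ) : p m (extRestrict a 1 X h ξ) =
      extRestrict a 1 _ h (p n ξ) := (extRestrict_comp a h ξ (Abelian.Ext.mk₀ π) (add_zero 1)).symm
  -- F is the limit of Ext^1(R/a^n, X) → Ext^1(R/a^n, X') ≅ Hom(R/a^n, N) → N, the last map being
  -- evaluation at 1.
  obtain ⟨F, hF⟩ := exists_localCohomology_desc a 1 X
    (fun n => extEvalOne a N n ∘ₗ (δ n).symm.toLinearMap ∘ₗ p n) (fun {n m} h ξ => by
      simp only [LinearMap.comp_apply, LinearEquiv.coe_coe]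
      rw [hp, hδ, extEvalOne_extRestrict])
  simp only [LinearMap.comp_apply, LinearEquiv.coe_coe] at hF
  have hinj : Function.Injective F := by
    refine (injective_iff_map_eq_zero _).2 fun x hx => ?_
    obtain ⟨n, ξ, rfl⟩ := exists_localCohomologyι_eq a 1 X x
    rw [hF] at hx
    have h1 := extEvalOne_injective a N n (hx.trans (map_zero _).symm)
    rw [LinearEquiv.symm_apply_eq, map_zero] at h1
    -- A class dying in Ext^1(R/a^n, X') comes from Ext^1(R/a^n, Γ(X)), where it eventually
    -- restricts to zero.
    obtain ⟨η, rfl⟩ := Abelian.Ext.covariant_sequence_exact₂ _ hT ξ h1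
    obtain ⟨m, hm, h0⟩ := extEventuallyZero_succ_of_torsion a 0 _
      (idealTorsion_idealTorsion a X) n η
    refine (localCohomologyι_eq_zero_iff a 1 X n _).2 ⟨m, hm, ?_⟩
    rw [extRestrict_comp, h0, Abelian.Ext.zero_comp]
  have hrange : LinearMap.range F = idealTorsion a (E ⧸ LinearMap.range f) := by
    ext y
    constructor
    · rintro ⟨x, rfl⟩
      obtain ⟨n, ξ, rfl⟩ := exists_localCohomologyι_eq a 1 X x
      rw [hF]
      exact extEvalOne_mem_idealTorsion a _
    · intro hy
      obtain ⟨n, η, hη⟩ := exists_extEvalOne_eq a (X := N) hy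
      -- The obstruction to lifting from X' to X lies in Ext^2(R/a^n, Γ(X)) and dies on some R/a^m.
      obtain ⟨m, hm, h0⟩ := extEventuallyZero_succ_of_torsion a 1 _
        (idealTorsion_idealTorsion a X) n ((δ n η).comp hT.extClass rfl)
      rw [extRestrict_comp] at h0
      obtain ⟨ζ, hζ⟩ := Abelian.Ext.covariant_sequence_exact₃ _ hT _ rfl h0
      refine ⟨localCohomologyι a 1 X m ζ, ?_⟩
      have h2 : p m ζ = extRestrict a 1 _ hm (δ n η) := hζ
      rw [hF, h2, hδ, LinearEquiv.symm_apply_apply, extEvalOne_extRestrict, hη]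
  exact ⟨LinearEquiv.ofInjective F hinj ≪≫ₗ LinearEquiv.ofEq _ _ hrange⟩

lemma nonempty_ext_localCohomologyModule_one_iso [IsNoetherianRing R] (X : ModuleCat.{u} R)
    (hX : ∀ i, 2 ≤ i → Subsingleton (localCohomologyModule a i X)) (i : ℕ) :
    Nonempty (extModule i (ModuleCat.of R (R ⧸ a)) (localCohomologyModule a 1 X) ≅
      extModule (i + 1) (ModuleCat.of R (R ⧸ a)) (ModuleCat.of R (X ⧸ idealTorsion a X))) := by
  obtain ⟨E, _, _, f, hE, hET, hf⟩ := exists_torsionFree_injective_embedding a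
    (X ⧸ idealTorsion a X) (idealTorsion_quotient_idealTorsion a X)
  obtain ⟨e⟩ := nonempty_localCohomologyModule_one_equiv a X hET f hf
  have hS := cokernelShortComplex_shortExact hf
  have hE' : Module.Injective R (cokernelShortComplex f).X₂ := hE
  have hM : ∀ r ∈ a ^ 1, ∀ x : ModuleCat.of R (R ⧸ a), r • x = 0 := fun r hr x => by
    obtain ⟨s, rfl⟩ := Ideal.Quotient.mk_surjective x
    rw [pow_one] at hr
    exact Ideal.Quotient.eq_zero_iff_mem.2 (a.mul_mem_right s hr)
  -- Degree j + 1 for N comes from degree j + 2 for X', hence for X.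
  have hN (j : ℕ) : ExtEventuallyZero a (j + 1) (cokernelShortComplex f).X₃ := by
    refine ExtEventuallyZero.of_succ a hS hET ?_
    refine ExtEventuallyZero.quotient_idealTorsion a ?_
    rw [extEventuallyZero_iff]
    exact hX _ (by lia)
  have hQ (j : ℕ) := subsingleton_ext_of_extEventuallyZero a 1 hM j
    (ModuleCat.of R ((cokernelShortComplex f).X₃ ⧸ idealTorsion a (cokernelShortComplex f).X₃))
    (idealTorsion_quotient_idealTorsion a _) fun k => (hN k).quotient_idealTorsion
  let M : ModuleCat.{u} R := ModuleCat.of R (R ⧸ a)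
  let e₁ : extModule i M (localCohomologyModule a 1 X) ≅
      extModule i M (ModuleCat.of R (idealTorsion a (E ⧸ LinearMap.range f))) :=
    ((Ext R (ModuleCat.{u} R) i).obj (op M)).mapIso e.toModuleIso
  let e₂ := extLinearEquivOfSubsingleton
    (submoduleShortComplex_shortExact (idealTorsion a (E ⧸ LinearMap.range f))) hQ i
  let e₃ := extShift hS (subsingleton_ext_of_torsionFree_injective a (E := ModuleCat.of R E)
    1 hM hET) i
  exact ⟨e₁ ≪≫ (extModuleLinearEquiv M _ i ≪≫ₗ e₂ ≪≫ₗ e₃ ≪≫ₗ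
    (extModuleLinearEquiv M _ (i + 1)).symm).toModuleIso⟩

lemma finite_extModule [IsNoetherianRing R] (i : ℕ) (M X : ModuleCat.{u} R)
    [Module.Finite R M] [Module.Finite R X] : Module.Finite R (extModule i M X) :=
  Module.Finite.equiv (extModuleLinearEquiv M X i).symm

/-- Torsion gives the support condition, and Ext between finitely generated modules over a
Noetherian ring is finitely generated. -/
lemma isIdealCofinite_localCohomologyModule_of_finite [IsNoetherianRing R] (i : ℕ)
    (X : ModuleCat.{u} R) [Module.Finite R (localCohomologyModule a i X)] :
    IsIdealCofinite a (localCohomologyModule a i X) :=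
  ⟨support_subset_zeroLocus_of_idealTorsion_eq_top a _ (idealTorsion_localCohomologyModule a i X),
    fun j => finite_extModule j (ModuleCat.of R (R ⧸ a)) _⟩

end Cofiniteness

end

theorem proposition3p5 {R : Type u} [CommRing R] [IsNoetherianRing R] (a : Ideal R)
    (X : ModuleCat.{u} R) (hcd : cohomologicalDimension a X = 1) :
    (∀ i : ℕ, Nonempty
      (extModule i (ModuleCat.of R (R ⧸ a)) (localCohomologyModule a 1 X) ≅
        extModule (i + 1) (ModuleCat.of R (R ⧸ a)) (ModuleCat.of R (X ⧸ idealTorsion a X)))) ∧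
    (Module.Finite R X → ∀ i : ℕ, IsIdealCofinite a (localCohomologyModule a i X)) := by
  have hX : ∀ i, 2 ≤ i → Subsingleton (localCohomologyModule a i X) := fun i hi => by
    by_contra h
    have := ((cohomologicalDimension_eq_iff a X 1).1 hcd).2 (not_subsingleton_iff_nontrivial.1 h)
    lia
  have hiso := nonempty_ext_localCohomologyModule_one_iso a X hX
  refine ⟨hiso, fun hfin i => ?_⟩
  match i with
  | 0 =>
    obtain ⟨F, hF⟩ := exists_localCohomologyModule_zero_injective a X
    have : Module.Finite R (localCohomologyModule a 0 X) := Module.Finite.of_injective F hF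
    exact isIdealCofinite_localCohomologyModule_of_finite a 0 X
  | 1 =>
    refine ⟨support_subset_zeroLocus_of_idealTorsion_eq_top a _
      (idealTorsion_localCohomologyModule a 1 X), fun j => ?_⟩
    obtain ⟨e⟩ := hiso j
    have := finite_extModule (j + 1) (ModuleCat.of R (R ⧸ a))
      (ModuleCat.of R (X ⧸ idealTorsion a X))
    exact Module.Finite.equiv e.toLinearEquiv.symm
  | i + 2 =>
    have := hX (i + 2) (by lia)
    exact isIdealCofinite_localCohomologyModule_of_finite a (i + 2) X
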